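/- Let $n\ge 1$. For a measurable function $f$ on $\mathbb R^n$ let $M_{HL,b}f(x)=\sup_{B\ni x}\frac1{|B|}\int_B|f|$, where the supremum is over all open Euclidean balls $B\subset\mathbb R^n$ containing $x$ (the uncentered Hardy–Littlewood maximal operator over balls). For $0<\alpha<1$ define the sharp Tauberian constant $$C_{HL,b}(\alpha)=\sup_{E}\frac{1}{|E|}\,\bigl|\{x\in\mathbb R^n: M_{HL,b}\chi_E(x)>\alpha\}\bigr|,$$ the supremum being over all measurable $E\subset\mathbb R^n$ with $0<|E|<\infty$, and define the halo function $\phi_{HL,b}$ on $[0,\infty)$ by $\phi_{HL,b}(x)=x$ for $0\le x\le 1$ and $\phi_{HL,b}(x)=C_{HL,b}(1/x)$ for $x>1$. For an interval $I\subset\mathbb R$ and $0<p\le 1$, write $f\in C^p(I)$ if for every compact $K\subset I$ there is a constant $A_K$ such that $|f(x)-f(y)|\le A_K|x-y|^p$ for all $x,y\in K$. Then $C_{HL,b}$ is finite on $(0,1)$, $\phi_{HL,b}$ is finite on $[0,\infty)$, and $$\phi_{HL,b}\in C^{1/(n+1)}([0,\infty)).$$ Moreover $C_{HL,b}\in C^{1/n}((0,1))$,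 and consequently $\phi_{HL,b}\in C^{1/n}((1,\infty))$. -/

import Mathlib

open MeasureTheory Set
open scoped ENNReal NNReal

/-- The geometric maximal operator `M_B f (x) = sup_{x ∈ R ∈ B} (1 / |R|) ∫_R |f|` of a collection
`B` of subsets of `ℝⁿ`, with values in `[0, ∞]`; it is `0` at points that lie in no member of `B`. -/
noncomputable def maximalOp {n : ℕ} (B : Set (Set (EuclideanSpace ℝ (Fin n))))
    (f : EuclideanSpace ℝ (Fin n) → ℝ) (x : EuclideanSpace ℝ (Fin n)) : ℝ≥0∞ :=
  ⨆ R ∈ {R | R ∈ B ∧ x ∈ R}, (∫⁻ y in R, ‖f y‖ₑ) / volume R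

/-- The halo set `{x : M_B χ_E (x) > α}`. -/
def haloSet {n : ℕ} (B : Set (Set (EuclideanSpace ℝ (Fin n)))) (α : ℝ)
    (E : Set (EuclideanSpace ℝ (Fin n))) : Set (EuclideanSpace ℝ (Fin n)) :=
  {x | ENNReal.ofReal α < maximalOp B (E.indicator fun _ => (1 : ℝ)) x}

/-- The sharp Tauberian constant
`C_B(α) = sup {|{x : M_B χ_E (x) > α}| / |E| : E measurable, 0 < |E| < ∞}` in `[0, ∞]`. -/
noncomputable def tauberianConst {n : ℕ} (B : Set (Set (EuclideanSpace ℝ (Fin n))))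
    (α : ℝ) : ℝ≥0∞ :=
  ⨆ E ∈ {E : Set (EuclideanSpace ℝ (Fin n)) |
      MeasurableSet E ∧ 0 < volume E ∧ volume E < ∞},
    volume (haloSet B α E) / volume E

/-- The halo function, on `[0, ∞)`: `φ_B(x) = x` for `x ≤ 1`, and
`φ_B(x) = sup {|{M_B χ_E > 1 / x}| / |E| : E measurable, 0 < |E| < ∞}` for `x > 1`. -/
noncomputable def haloFun {n : ℕ} (B : Set (Set (EuclideanSpace ℝ (Fin n))))
    (x : ℝ) : ℝ≥0∞ :=
  if x ≤ 1 then ENNReal.ofReal x else tauberianConst B (1 / x)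

/-- The collection of all (open) Euclidean balls of `ℝⁿ`. -/
def ballBasis (n : ℕ) : Set (Set (EuclideanSpace ℝ (Fin n))) :=
  {R | ∃ (c : EuclideanSpace ℝ (Fin n)) (r : ℝ), 0 < r ∧ R = Metric.ball c r}

/-- The (local) Hölder class `C^p(I)`: for every compact `K ⊆ I` there is a constant `A` with
`|f x - f y| ≤ A |x - y| ^ p` for all `x, y ∈ K`. -/
def LocHolderClass (p : ℝ≥0) (I : Set ℝ) (f : ℝ → ℝ) : Prop :=
  ∀ K : Set ℝ, K ⊆ I → IsCompact K → ∃ A : ℝ≥0, HolderOnWith A p f K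

/-!
Write `Ψ(α) = max 1 C(α)`; since `C ≥ 1` on `(0, 1)` and `C = 0` on `[1, ∞)`, this extends `C` from
`(0, 1)` by the value `1`. Everything follows from the self-improvement
`(1 - δ) ^ N * Ψ(α) ≤ Ψ(α * (1 + c * δ ^ n))`, `0 < δ < 1`: iterating it until the argument passes
`1` gives finiteness, and with `δ` of size `|α - β| ^ (1 / n)` it gives the Hölder estimate.

The inequality comes from enlarging `E`. By the maximal ergodic theorem the one-sided directional
maximal function satisfies the weak type inequality with constant `1`, so adjoining to `E` the halos
at level `1 - δ` along `N` suitable directions yields `E'` with `(1 - δ) ^ N * |E'| ≤ |E|`. From any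
point of a ball one of `2n` cones of these directions stays inside the ball for a length comparable
to the radius, whence `E'` contains every ball in which `E` misses less than a proportion
`s ~ δ ^ n`. If a ball `B` is not contained in `E'`, almost every point of `E ∩ B` lies on the
boundary of, or inside, a smaller ball in `B` in which `E` misses exactly the proportion `s / 2`;
such balls are contained in `E'`, and Vitali's covering lemma gives
`|E' ∩ B| ≥ (1 + c * δ ^ n) * |E ∩ B|`. Hence the halo of `E` at level `α` is contained, up to balls
inside `E'`, in the halo of `E'` at level `α * (1 + c * δ ^ n)`.
-/

section MaximalErgodic

variable {X : Type*} {T : X → X} {f : X → ℝ≥0∞} {c : ℝ≥0∞}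

/-- The largest excess `∑ i < m, (f (T^i x) - c)` over `m ≤ k` of an orbit sum over the constant
`c`. The recursion from the left end of the orbit keeps all terms in `[0, ∞]`. -/
noncomputable def orbitExcess (T : X → X) (f : X → ℝ≥0∞) (c : ℝ≥0∞) : ℕ → X → ℝ≥0∞
  | 0, _ => 0
  | k + 1, x => f x + orbitExcess T f c k (T x) - c

theorem orbitExcess_le_succ (k : ℕ) (x : X) :
    orbitExcess T f c k x ≤ orbitExcess T f c (k + 1) x := by
  induction k generalizing x with
  | zero => exact zero_le
  | succ k ih => exact tsub_le_tsub_right (add_le_add_right (ih (T x)) _) c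

theorem birkhoffSum_le_add_orbitExcess (k : ℕ) (x : X) :
    birkhoffSum T f k x ≤ k * c + orbitExcess T f c k x := by
  induction k generalizing x with
  | zero => simp
  | succ k ih =>
    calc birkhoffSum T f (k + 1) x
        = f x + birkhoffSum T f k (T x) := birkhoffSum_succ' T f k x
      _ ≤ f x + (k * c + orbitExcess T f c k (T x)) := by gcongr; exact ih (T x)
      _ = k * c + (f x + orbitExcess T f c k (T x)) := by ring
      _ ≤ k * c + (c + orbitExcess T f c (k + 1) x) := by gcongr _ + ?_; exact le_add_tsub
      _ = (k + 1 : ℕ) * c + orbitExcess T f c (k + 1) x := by push_cast; ring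

theorem orbitExcess_add_indicator_le (k : ℕ) (x : X) :
    orbitExcess T f c k x + {y | 0 < orbitExcess T f c k y}.indicator (fun _ => c) x ≤
      f x + orbitExcess T f c k (T x) := by
  by_cases hx : 0 < orbitExcess T f c k x
  · rw [indicator_of_mem (by exact hx)]
    cases k with
    | zero => simp [orbitExcess] at hx
    | succ k =>
      calc orbitExcess T f c (k + 1) x + c = f x + orbitExcess T f c k (T x) :=
            tsub_add_cancel_of_le (tsub_pos_iff_lt.1 hx).le
        _ ≤ _ := by gcongr; exact orbitExcess_le_succ k (T x)
  · rw [indicator_of_notMem (by exact hx), not_lt.1 hx |> nonpos_iff_eq_zero.1]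
    simp

variable [MeasurableSpace X] {μ : Measure X}

theorem measurable_orbitExcess (hT : Measurable T) (hf : Measurable f) (k : ℕ) :
    Measurable (orbitExcess T f c k) := by
  induction k with
  | zero => exact measurable_const
  | succ k ih => exact (hf.add (ih.comp hT)).sub measurable_const

theorem lintegral_orbitExcess_le (hT : MeasurePreserving T μ μ) (hf : Measurable f) (k : ℕ) :
    ∫⁻ x, orbitExcess T f c k x ∂μ ≤ k * ∫⁻ x, f x ∂μ := by
  induction k with
  | zero => simp [orbitExcess]
  | succ k ih =>
    calc ∫⁻ x, orbitExcess T f c (k + 1) x ∂μ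
        ≤ ∫⁻ x, f x + orbitExcess T f c k (T x) ∂μ := lintegral_mono fun x => tsub_le_self
      _ = ∫⁻ x, f x ∂μ + ∫⁻ x, orbitExcess T f c k x ∂μ := by
          rw [lintegral_add_left hf, hT.lintegral_comp (measurable_orbitExcess hT.measurable hf k)]
      _ ≤ ∫⁻ x, f x ∂μ + k * ∫⁻ x, f x ∂μ := by gcongr
      _ = (k + 1 : ℕ) * ∫⁻ x, f x ∂μ := by push_cast; ring

theorem mul_measure_orbitExcess_pos_le (hT : MeasurePreserving T μ μ) (hf : Measurable f)
    (k : ℕ) : c * μ {x | 0 < orbitExcess T f c k x} ≤ ∫⁻ x, f x ∂μ := by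
  rcases eq_or_ne (∫⁻ x, f x ∂μ) ∞ with htop | hfin
  · exact htop ▸ le_top
  have hm : Measurable (orbitExcess T f c k) := measurable_orbitExcess hT.measurable hf k
  have hfin' : ∫⁻ x, orbitExcess T f c k x ∂μ ≠ ∞ :=
    ne_top_of_le_ne_top (by finiteness) (lintegral_orbitExcess_le hT hf k)
  refine (ENNReal.add_le_add_iff_left hfin').1 ?_
  calc ∫⁻ x, orbitExcess T f c k x ∂μ + c * μ {x | 0 < orbitExcess T f c k x}
      = ∫⁻ x, orbitExcess T f c k x +
          {y | 0 < orbitExcess T f c k y}.indicator (fun _ => c) x ∂μ := by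
        rw [lintegral_add_left hm, lintegral_indicator_const (measurableSet_lt measurable_const hm)]
    _ ≤ ∫⁻ x, f x + orbitExcess T f c k (T x) ∂μ :=
        lintegral_mono (orbitExcess_add_indicator_le k)
    _ = ∫⁻ x, orbitExcess T f c k x ∂μ + ∫⁻ x, f x ∂μ := by
        rw [lintegral_add_left hf, hT.lintegral_comp hm, add_comm]

theorem mul_measure_exists_lt_birkhoffSum_le (hT : MeasurePreserving T μ μ)
    (hf : Measurable f) (c : ℝ≥0∞) :
    c * μ {x | ∃ k : ℕ, k * c < birkhoffSum T f k x} ≤ ∫⁻ x, f x ∂μ := by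
  have hsub : {x | ∃ k : ℕ, k * c < birkhoffSum T f k x} ⊆
      ⋃ k, {x | 0 < orbitExcess T f c k x} := by
    rintro x ⟨k, hk⟩
    refine mem_iUnion.2 ⟨k, (pos_iff_ne_zero.2 fun h0 => hk.not_ge ?_ :
      0 < orbitExcess T f c k x)⟩
    simpa [h0] using birkhoffSum_le_add_orbitExcess (T := T) (f := f) (c := c) k x
  have hmono : Monotone fun k => {x | 0 < orbitExcess T f c k x} :=
    monotone_nat_of_le_succ fun k x hx => lt_of_lt_of_le hx (orbitExcess_le_succ k x)
  calc _ ≤ c * μ (⋃ k, {x | 0 < orbitExcess T f c k x}) := by gcongr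
    _ = ⨆ k, c * μ {x | 0 < orbitExcess T f c k x} := by
      rw [hmono.measure_iUnion, ENNReal.mul_iSup]
    _ ≤ _ := iSup_le fun k => mul_measure_orbitExcess_pos_le hT hf k

end MaximalErgodic

section DirectionalHalo

theorem ae_exists_lt_volume_inter_Ioc {S : Set ℝ} (hS : MeasurableSet S) {lam : ℝ≥0∞}
    (hlam : lam < 1) : ∀ᵐ s, s ∈ S →
      ∃ m : ℕ, lam * ENNReal.ofReal (1 / 2 ^ m) < volume (S ∩ Ioc s (s + 1 / 2 ^ m)) := by
  have hdensity := IsUnifLocDoublingMeasure.ae_tendsto_measure_inter_div volume S 1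
  rw [ae_restrict_iff' hS] at hdensity
  filter_upwards [hdensity] with s hlim hs
  have hδ : Filter.Tendsto (fun m : ℕ => (1 / 2 ^ m / 2 : ℝ)) Filter.atTop
      (nhdsWithin 0 (Ioi 0)) := by
    refine tendsto_nhdsWithin_iff.2 ⟨?_, .of_forall fun m => mem_Ioi.2 (by positivity)⟩
    simpa [div_eq_mul_inv] using (tendsto_pow_atTop_nhds_zero_of_lt_one (r := (2⁻¹ : ℝ))
      (by norm_num) (by norm_num)).mul_const 2⁻¹
  have hratio := hlim hs (fun m : ℕ => s + 1 / 2 ^ m / 2) _ hδ (.of_forall fun m => by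
    rw [one_mul, Metric.mem_closedBall, dist_self_add_right, Real.norm_of_nonneg (by positivity)])
  obtain ⟨m, hm⟩ := (hratio.eventually_const_lt hlam).exists
  refine ⟨m, ?_⟩
  rw [Real.volume_closedBall, mul_div_cancel₀ _ two_ne_zero, Real.closedBall_eq_Icc,
    add_sub_cancel_right, add_assoc, add_halves] at hm
  rw [measure_congr ((ae_eq_refl S).inter Ioc_ae_eq_Icc)]
  exact (ENNReal.lt_div_iff_mul_lt (by simp) (by simp)).1 hm

variable {V : Type*} [AddCommGroup V] [Module ℝ V]

/-- The length of the part in `E` of the segment from `x` to `x + ρ • v`, parametrised by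
`(0, ρ]`. -/
noncomputable def segMass (v : V) (ρ : ℝ) (E : Set V) (x : V) : ℝ≥0∞ :=
  volume (Ioc 0 ρ ∩ {s : ℝ | x + s • v ∈ E})

/-- The set where some forward average of the indicator of `E` along `v` exceeds `lam`. Only
segments of dyadic length are used, so that the set is measurable and a monotone union over the
meshes `1 / 2 ^ m`. -/
def dirHalo (v : V) (lam : ℝ≥0∞) (E : Set V) : Set V :=
  {x | ∃ m k : ℕ, lam * ENNReal.ofReal (k / 2 ^ m) < segMass v (k / 2 ^ m) E x}

variable {v : V} {ρ : ℝ} {lam : ℝ≥0∞} {E F : Set V} {x : V}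

theorem segMass_mono (h : E ⊆ F) : segMass v ρ E x ≤ segMass v ρ F x :=
  measure_mono (inter_subset_inter_right _ fun _ hs => h hs)

theorem segMass_add_le (a b : ℝ) :
    segMass v (a + b) E x ≤ segMass v a E x + segMass v b E (x + a • v) := by
  have hsub : Ioc 0 (a + b) ∩ {s : ℝ | x + s • v ∈ E} ⊆
      Ioc 0 a ∩ {s : ℝ | x + s • v ∈ E} ∪ Ioc a (a + b) ∩ {s : ℝ | x + s • v ∈ E} := by
    rintro s ⟨⟨h0, hab⟩, hs⟩
    rcases le_or_gt s a with h | h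
    exacts [Or.inl ⟨⟨h0, h⟩, hs⟩, Or.inr ⟨⟨h, hab⟩, hs⟩]
  have htrans : (fun s => s + a) ⁻¹' (Ioc a (a + b) ∩ {s : ℝ | x + s • v ∈ E}) =
      Ioc 0 b ∩ {s : ℝ | x + a • v + s • v ∈ E} := by
    ext s
    simp [add_smul, add_assoc, add_comm (s • v)]
  calc segMass v (a + b) E x
      ≤ _ := (measure_mono hsub).trans (measure_union_le _ _)
    _ = segMass v a E x + segMass v b E (x + a • v) := by
      rw [← measure_preimage_add_right volume a (Ioc a (a + b) ∩ _), htrans, segMass, segMass]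

theorem segMass_natCast_mul_le_birkhoffSum (k : ℕ) (h : ℝ) (x : V) :
    segMass v (k * h) E x ≤ birkhoffSum (· + h • v) (segMass v h E) k x := by
  induction k generalizing x with
  | zero => simp [segMass]
  | succ k ih =>
    rw [birkhoffSum_succ', Nat.cast_succ, show (k + 1 : ℝ) * h = h + k * h by ring]
    exact (segMass_add_le _ _).trans (by gcongr; exact ih _)

theorem dirHalo_mono (h : E ⊆ F) : dirHalo v lam E ⊆ dirHalo v lam F :=
  fun _ ⟨m, k, hk⟩ => ⟨m, k, hk.trans_le (segMass_mono h)⟩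

variable [MeasurableSpace V] [MeasurableAdd₂ V] [MeasurableSMul ℝ V]

theorem measurableSet_line (hE : MeasurableSet E) (v x : V) :
    MeasurableSet {s : ℝ | x + s • v ∈ E} :=
  (show Measurable fun s : ℝ => x + s • v by fun_prop) hE

theorem measurableSet_segment_prod (hE : MeasurableSet E) (v : V) (ρ : ℝ) :
    MeasurableSet {p : V × ℝ | p.2 ∈ Ioc 0 ρ ∧ p.1 + p.2 • v ∈ E} :=
  (measurable_snd measurableSet_Ioc).inter
    ((show Measurable fun p : V × ℝ => p.1 + p.2 • v by fun_prop) hE)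

theorem measurable_segMass (hE : MeasurableSet E) : Measurable (segMass v ρ E) :=
  measurable_measure_prodMk_left (measurableSet_segment_prod hE v ρ)

theorem measurableSet_dirHalo (hE : MeasurableSet E) : MeasurableSet (dirHalo v lam E) := by
  simp only [dirHalo, ofPred_exists]
  exact .iUnion fun m => .iUnion fun k =>
    measurableSet_lt measurable_const (measurable_segMass hE)

theorem volume_line_diff_dirHalo (hlam : lam < 1) (hE : MeasurableSet E) (x : V) :
    volume {s : ℝ | x + s • v ∈ E \ dirHalo v lam E} = 0 := by
  refine measure_eq_zero_iff_ae_notMem.2 ?_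
  filter_upwards [ae_exists_lt_volume_inter_Ioc (measurableSet_line hE v x) hlam] with s hs hmem
  obtain ⟨m, hm⟩ := hs hmem.1
  have htrans : (fun t => t + s) ⁻¹' ({s : ℝ | x + s • v ∈ E} ∩ Ioc s (s + 1 / 2 ^ m)) =
      Ioc 0 (1 / 2 ^ m) ∩ {t : ℝ | x + s • v + t • v ∈ E} := by
    ext t
    simp [add_smul, add_assoc, add_comm (t • v), add_comm s, and_comm]
  rw [← measure_preimage_add_right volume s, htrans] at hm
  exact hmem.2 ⟨m, 1, by simpa only [Nat.cast_one, segMass] using hm⟩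

variable {μ : Measure V} [SFinite μ] [μ.IsAddLeftInvariant]

theorem lintegral_segMass (hE : MeasurableSet E) (v : V) (ρ : ℝ) :
    ∫⁻ x, segMass v ρ E x ∂μ = ENNReal.ofReal ρ * μ E := by
  have hslice (s : ℝ) : μ {x | s ∈ Ioc 0 ρ ∧ x + s • v ∈ E} =
      (Ioc 0 ρ).indicator (fun _ => μ E) s := by
    by_cases hs : s ∈ Ioc 0 ρ
    · simp only [hs, true_and, indicator_of_mem]
      exact measure_preimage_add_right μ (s • v) E
    · simp [hs]
  calc ∫⁻ x, segMass v ρ E x ∂μ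
      = (μ.prod volume) {p : V × ℝ | p.2 ∈ Ioc 0 ρ ∧ p.1 + p.2 • v ∈ E} :=
        (Measure.prod_apply (measurableSet_segment_prod hE v ρ)).symm
    _ = ∫⁻ s, μ {x | s ∈ Ioc 0 ρ ∧ x + s • v ∈ E} :=
        Measure.prod_apply_symm (measurableSet_segment_prod hE v ρ)
    _ = ENNReal.ofReal ρ * μ E := by
      simp only [hslice, lintegral_indicator_const measurableSet_Ioc, Real.volume_Ioc, sub_zero,
        mul_comm]

theorem mul_measure_dirHalo_le (v : V) (lam : ℝ≥0∞) (hE : MeasurableSet E) :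
    lam * μ (dirHalo v lam E) ≤ μ E := by
  set A : ℕ → Set V := fun m =>
    {x | ∃ k : ℕ, lam * ENNReal.ofReal (k / 2 ^ m) < segMass v (k / 2 ^ m) E x}
  have hmono : Monotone A := by
    refine monotone_nat_of_le_succ fun m x ⟨k, hk⟩ => ⟨2 * k, ?_⟩
    have hrefine : ((2 * k : ℕ) : ℝ) / 2 ^ (m + 1) = k / 2 ^ m := by
      push_cast
      rw [pow_succ']
      exact mul_div_mul_left _ _ two_ne_zero
    rwa [hrefine]
  have hmesh (m : ℕ) : lam * μ (A m) ≤ μ E := by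
    set h : ℝ := 1 / 2 ^ m with hh
    have hpos : ENNReal.ofReal h ≠ 0 := by simp [hh]
    have hsub : A m ⊆ {x | ∃ k : ℕ, k * (lam * ENNReal.ofReal h) <
        birkhoffSum (· + h • v) (segMass v h E) k x} := by
      rintro x ⟨k, hk⟩
      refine ⟨k, lt_of_eq_of_lt ?_ (hk.trans_le ?_)⟩
      · rw [show (k : ℝ) / 2 ^ m = k * h by rw [hh]; ring, ENNReal.ofReal_mul (by positivity),
          ENNReal.ofReal_natCast]
        ring
      · rw [show (k : ℝ) / 2 ^ m = k * h by rw [hh]; ring]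
        exact segMass_natCast_mul_le_birkhoffSum k h x
    refine (ENNReal.mul_le_mul_iff_right hpos ENNReal.ofReal_ne_top).1 ?_
    calc ENNReal.ofReal h * (lam * μ (A m)) = lam * ENNReal.ofReal h * μ (A m) := by ring
      _ ≤ _ := by gcongr
      _ ≤ ∫⁻ x, segMass v h E x ∂μ := mul_measure_exists_lt_birkhoffSum_le
          (measurePreserving_add_right μ (h • v)) (measurable_segMass hE) _
      _ = ENNReal.ofReal h * μ E := lintegral_segMass hE v h
  have hunion : dirHalo v lam E = ⋃ m, A m := ofPred_exists _
  rw [hunion, hmono.measure_iUnion, ENNReal.mul_iSup]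
  exact iSup_le hmesh

theorem measure_diff_dirHalo (hlam : lam < 1) (hE : MeasurableSet E) :
    μ (E \ dirHalo v lam E) = 0 := by
  have hdiff : MeasurableSet (E \ dirHalo v lam E) := hE.diff (measurableSet_dirHalo hE)
  have hint := lintegral_segMass (μ := μ) hdiff v 1
  have hzero (x : V) : segMass v 1 (E \ dirHalo v lam E) x = 0 :=
    measure_mono_null inter_subset_right (volume_line_diff_dirHalo hlam hE x)
  simpa [hzero] using hint.symm

theorem mul_measure_union_dirHalo_le (hlam : lam < 1) (hE : MeasurableSet E) (v : V) :
    lam * μ (E ∪ dirHalo v lam E) ≤ μ E := by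
  rw [← sdiff_union_self, measure_congr (union_ae_eq_right_of_ae_eq_empty
    (ae_eq_empty.2 (measure_diff_dirHalo hlam hE)))]
  exact mul_measure_dirHalo_le v lam hE

end DirectionalHalo

section IteratedHalo

variable {V : Type*} [AddCommGroup V] [Module ℝ V] {v : V} {lam : ℝ≥0∞} {E F : Set V} {x : V}

/-- The set obtained from `E` by adjoining successively the directional halos along the vectors of
a list, starting from the last one. -/
def iterHalo (lam : ℝ≥0∞) (L : List V) (E : Set V) : Set V :=
  L.foldr (fun v F => F ∪ dirHalo v lam F) E

theorem iterHalo_cons (L : List V) :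
    iterHalo lam (v :: L) E = iterHalo lam L E ∪ dirHalo v lam (iterHalo lam L E) :=
  rfl

theorem iterHalo_subset_of_sublist {L₁ L₂ : List V} (h : L₁.Sublist L₂) :
    iterHalo lam L₁ E ⊆ iterHalo lam L₂ E := by
  induction h with
  | slnil => exact Subset.rfl
  | cons v _ ih => exact ih.trans subset_union_left
  | cons_cons v _ ih => exact union_subset_union ih (dirHalo_mono ih)

theorem subset_iterHalo (L : List V) : E ⊆ iterHalo lam L E :=
  iterHalo_subset_of_sublist L.nil_sublist

theorem le_volume_escape_of_notMem_dirHalo {m k : ℕ} (hx : x ∉ dirHalo v lam E) :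
    (1 - lam) * ENNReal.ofReal (k / 2 ^ m) ≤
      volume (Ioc (0 : ℝ) (k / 2 ^ m) ∩ {s : ℝ | x + s • v ∉ E}) := by
  have hseg : segMass v (k / 2 ^ m) E x ≤ lam * ENNReal.ofReal (k / 2 ^ m) :=
    not_lt.1 fun h => hx ⟨m, k, h⟩
  rw [ENNReal.sub_mul (by simp), one_mul, tsub_le_iff_left]
  calc ENNReal.ofReal (k / 2 ^ m) = volume (Ioc (0 : ℝ) (k / 2 ^ m)) := by simp
    _ ≤ segMass v (k / 2 ^ m) E x + _ :=
        measure_le_inter_add_sdiff _ _ {s : ℝ | x + s • v ∈ E}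
    _ ≤ _ := add_le_add_left hseg _

variable [MeasurableSpace V] [MeasurableAdd₂ V] [MeasurableSMul ℝ V]

theorem measurableSet_iterHalo (hE : MeasurableSet E) (L : List V) :
    MeasurableSet (iterHalo lam L E) := by
  induction L with
  | nil => exact hE
  | cons v L ih => exact ih.union (measurableSet_dirHalo ih)

theorem pow_mul_measure_iterHalo_le {μ : Measure V} [SFinite μ] [μ.IsAddLeftInvariant]
    (hlam : lam < 1) (hE : MeasurableSet E) (L : List V) :
    lam ^ L.length * μ (iterHalo lam L E) ≤ μ E := by
  induction L with
  | nil => simp [iterHalo]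
  | cons v L ih =>
    calc lam ^ (L.length + 1) * μ (iterHalo lam (v :: L) E)
        = lam ^ L.length * (lam * μ (iterHalo lam (v :: L) E)) := by ring
      _ ≤ lam ^ L.length * μ (iterHalo lam L E) := by
          gcongr
          exact mul_measure_union_dirHalo_le hlam (measurableSet_iterHalo hE L) v
      _ ≤ μ E := ih

theorem volume_pi_succ_eq_lintegral {d : ℕ} {W : Set (Fin (d + 1) → ℝ)} (hW : MeasurableSet W) :
    volume W = ∫⁻ a : ℝ, volume {s : Fin d → ℝ | (Fin.cons a s : Fin (d + 1) → ℝ) ∈ W} := by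
  have hmp := (volume_preserving_piFinSuccAbove (fun _ : Fin (d + 1) => ℝ) 0).symm
  rw [← hmp.measure_preimage_equiv, Measure.volume_eq_prod,
    Measure.prod_apply ((MeasurableEquiv.measurable _) hW)]
  refine lintegral_congr fun a => congrArg _ (ext fun s => ?_)
  simp [MeasurableEquiv.piFinSuccAbove, Fin.insertNthEquiv]

theorem measurableSet_box {ι : Type*} [Fintype ι] (hE : MeasurableSet E) (v : ι → V) (ρ : ℝ)
    (x : V) :
    MeasurableSet {s : ι → ℝ | (∀ j, s j ∈ Ioc 0 ρ) ∧ x + ∑ j, s j • v j ∈ E} := by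
  have hcube : MeasurableSet {s : ι → ℝ | ∀ j, s j ∈ Ioc 0 ρ} := by
    simp only [ofPred_forall]
    exact .iInter fun j => measurable_pi_apply j measurableSet_Ioc
  exact hcube.inter ((show Measurable fun s : ι → ℝ => x + ∑ j, s j • v j by fun_prop) hE)

theorem le_volume_box_of_notMem_iterHalo {m k d : ℕ} (v : Fin d → V) (hE : MeasurableSet E)
    (hx : x ∉ iterHalo lam (List.ofFn v) E) :
    ((1 - lam) * ENNReal.ofReal (k / 2 ^ m)) ^ d ≤
      volume {s : Fin d → ℝ | (∀ j, s j ∈ Ioc (0 : ℝ) (k / 2 ^ m)) ∧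
        x + ∑ j, s j • v j ∈ Eᶜ} := by
  induction d generalizing x with
  | zero =>
    have huniv : {s : Fin 0 → ℝ | (∀ j, s j ∈ Ioc (0 : ℝ) (k / 2 ^ m)) ∧
        x + ∑ j, s j • v j ∈ Eᶜ} = univ := by
      ext s
      simpa [iterHalo] using hx
    rw [huniv, pow_zero, volume_pi, Measure.pi_univ, Finset.univ_eq_empty, Finset.prod_empty]
  | succ d ih =>
    set ρ : ℝ := k / 2 ^ m
    set q := (1 - lam) * ENNReal.ofReal ρ
    set G := iterHalo lam (List.ofFn fun j => v j.succ) E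
    have hG : MeasurableSet G := measurableSet_iterHalo hE _
    rw [List.ofFn_succ, iterHalo_cons] at hx
    have hfirst : q ≤ volume (Ioc (0 : ℝ) ρ ∩ {a : ℝ | x + a • v 0 ∉ G}) :=
      le_volume_escape_of_notMem_dirHalo fun h => hx (Or.inr h)
    have hmeas : MeasurableSet (Ioc (0 : ℝ) ρ ∩ {a : ℝ | x + a • v 0 ∉ G}) :=
      measurableSet_Ioc.inter (measurableSet_line hG.compl (v 0) x)
    rw [volume_pi_succ_eq_lintegral (measurableSet_box hE.compl v ρ x)]
    calc q ^ (d + 1) ≤ q ^ d * volume (Ioc (0 : ℝ) ρ ∩ {a : ℝ | x + a • v 0 ∉ G}) := by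
          rw [pow_succ]; gcongr
      _ = ∫⁻ _ in Ioc (0 : ℝ) ρ ∩ {a : ℝ | x + a • v 0 ∉ G}, q ^ d := by
          rw [setLIntegral_const]
      _ ≤ ∫⁻ a in Ioc (0 : ℝ) ρ ∩ {a : ℝ | x + a • v 0 ∉ G}, _ := by
          refine setLIntegral_mono' hmeas fun a ha => ?_
          refine (ih (fun j => v j.succ) ha.2).trans (measure_mono fun s hs => ?_)
          refine ⟨Fin.forall_fin_succ.2 ⟨ha.1, hs.1⟩, ?_⟩
          rw [Fin.sum_univ_succ, ← add_assoc]
          exact hs.2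
      _ ≤ _ := setLIntegral_le_lintegral _ _

end IteratedHalo

theorem exists_mul_volume_coord_eq_measure {V ι : Type*} [NormedAddCommGroup V] [NormedSpace ℝ V]
    [MeasurableSpace V] [BorelSpace V] [Fintype ι] (b : Module.Basis ι ℝ V) (μ : Measure V)
    [μ.IsAddHaarMeasure] :
    ∃ κ : ℝ≥0, 0 < κ ∧ ∀ (x : V) (S : Set V),
      κ * volume {s : ι → ℝ | x + ∑ j, s j • b j ∈ S} = μ S := by
  have : FiniteDimensional ℝ V := b.finiteDimensional_of_finite
  set e : (ι → ℝ) ≃L[ℝ] V := b.equivFunL.symm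
  set ν : Measure V := Measure.map e volume
  have : ν.IsAddHaarMeasure := e.isAddHaarMeasure_map _
  refine ⟨Measure.addHaarScalarFactor μ ν, Measure.addHaarScalarFactor_pos_of_isAddHaarMeasure μ ν,
    fun x S => ?_⟩
  have hpre : {s : ι → ℝ | x + ∑ j, s j • b j ∈ S} = e ⁻¹' ((x + ·) ⁻¹' S) := by
    ext s
    exact iff_of_eq (congrArg (fun y => x + y ∈ S) (b.equivFun_symm_apply s).symm)
  have hν_apply (S' : Set V) : ν S' = volume (e ⁻¹' S') :=
    e.toHomeomorph.toMeasurableEquiv.map_apply S'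
  rw [hpre, ← hν_apply, measure_preimage_add]
  conv_rhs => rw [Measure.isAddLeftInvariant_eq_smul μ ν]
  rfl

section AxisFrames

variable {n : ℕ}

/-- The vectors `2σ e i + e j`, a frame of vectors leaning towards the axis direction `σ e i`; the
sign `σ` is encoded as a unit of `ℤ`. -/
def axisFrame {V : Type*} [AddCommGroup V] [Module ℝ V] (e : Fin n → V) (i : Fin n) (σ : ℤˣ)
    (j : Fin n) : V :=
  (2 * ((σ : ℤ) : ℝ)) • e i + e j

/-- The directions occurring in the axis frames of `e`, listed frame by frame. -/
noncomputable def axisDirections {V : Type*} [AddCommGroup V] [Module ℝ V] (e : Fin n → V) :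
    List V :=
  (Finset.univ : Finset (Fin n × ℤˣ)).toList.flatMap fun p => List.ofFn (axisFrame e p.1 p.2)

theorem linearIndependent_axisFrame {V : Type*} [AddCommGroup V] [Module ℝ V] {e : Fin n → V}
    (he : LinearIndependent ℝ e) (i : Fin n) (σ : ℤˣ) :
    LinearIndependent ℝ (axisFrame e i σ) := by
  rw [Fintype.linearIndependent_iff] at he ⊢
  intro g hg
  have hcoord : ∀ k, (if k = i then (∑ j, g j) * (2 * ((σ : ℤ) : ℝ)) else 0) + g k = 0 := by
    refine he _ ?_
    simpa [axisFrame, smul_add, Finset.sum_add_distrib, ← Finset.sum_smul, smul_smul, add_smul,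
      ite_smul, Finset.sum_mul] using hg
  have hne (k : Fin n) (hk : k ≠ i) : g k = 0 := by simpa [hk] using hcoord k
  have hi : g i = 0 := by
    have hodd : (2 * (σ : ℤ) + 1 : ℤ) ≠ 0 := by omega
    have h := hcoord i
    rw [if_pos rfl, Finset.sum_eq_single i (fun j _ hj => hne j hj) (by simp)] at h
    have hmul : g i * ((2 * (σ : ℤ) + 1 : ℤ) : ℝ) = 0 := by push_cast; linarith
    exact (mul_eq_zero.1 hmul).resolve_right (Int.cast_ne_zero.2 hodd)
  exact fun k => (eq_or_ne k i).elim (fun h => h ▸ hi) (hne k)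

variable {V : Type*} [NormedAddCommGroup V] [InnerProductSpace ℝ V]
  (b : OrthonormalBasis (Fin n) ℝ V) {i : Fin n} {σ : ℤˣ} {y : V} {s : Fin n → ℝ}

theorem norm_sum_smul_axisFrame_le (hs : ∀ j, 0 ≤ s j) :
    ‖∑ j, s j • axisFrame b i σ j‖ ≤ 3 * ∑ j, s j := by
  have hframe (j : Fin n) : ‖axisFrame b i σ j‖ ≤ 3 := by
    have hσ : ‖((σ : ℤ) : ℝ)‖ = 1 := by
      rcases Int.units_eq_one_or σ with rfl | rfl <;> simp
    refine (norm_add_le _ _).trans (le_of_eq ?_)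
    rw [norm_smul, norm_mul, hσ, b.norm_eq_one, b.norm_eq_one]
    norm_num
  rw [Finset.mul_sum]
  refine (norm_sum_le _ _).trans (Finset.sum_le_sum fun j _ => ?_)
  rw [norm_smul, Real.norm_of_nonneg (hs j), mul_comm]
  exact mul_le_mul_of_nonneg_right (hframe j) (hs j)

theorem inner_sum_smul_axisFrame_le (hs : ∀ j, 0 ≤ s j)
    (hi : ∀ j, |inner ℝ y (b j)| ≤ |inner ℝ y (b i)|)
    (hσ : ((σ : ℤ) : ℝ) * inner ℝ y (b i) = -|inner ℝ y (b i)|) :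
    inner ℝ y (∑ j, s j • axisFrame b i σ j) ≤ -|inner ℝ y (b i)| * ∑ j, s j := by
  rw [inner_sum, Finset.mul_sum]
  refine Finset.sum_le_sum fun j _ => ?_
  rw [inner_smul_right, mul_comm, axisFrame, inner_add_right, inner_smul_right, mul_assoc, hσ]
  refine mul_le_mul_of_nonneg_right ?_ (hs j)
  linarith [hi j, le_abs_self (inner ℝ y (b j))]

theorem norm_le_mul_abs_inner (hi : ∀ j, |inner ℝ y (b j)| ≤ |inner ℝ y (b i)|) :
    ‖y‖ ≤ n * |inner ℝ y (b i)| := by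
  calc ‖y‖ = ‖∑ j, inner ℝ (b j) y • b j‖ := by rw [b.sum_repr']
    _ ≤ ∑ _j : Fin n, |inner ℝ y (b i)| := norm_sum_le_of_le _ fun j _ => by
        rw [norm_smul, b.norm_eq_one, mul_one, Real.norm_eq_abs, real_inner_comm]
        exact hi j
    _ = n * |inner ℝ y (b i)| := by simp

theorem exists_axisFrame_box_subset_ball [NeZero n] {r ρ : ℝ}
    (hy : ‖y‖ < r) (hρ : ρ ≤ r / (9 * n ^ 2)) :
    ∃ i σ, ∀ s : Fin n → ℝ, (∀ j, s j ∈ Ioc 0 ρ) →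
      ‖y + ∑ j, s j • axisFrame b i σ j‖ < r := by
  -- Walk towards the centre: along the axis with the largest coordinate of `y`, with opposite sign.
  obtain ⟨i, hi⟩ := Finite.exists_max fun j => |inner ℝ y (b j)|
  obtain ⟨σ, hσ⟩ : ∃ σ : ℤˣ, ((σ : ℤ) : ℝ) * inner ℝ y (b i) = -|inner ℝ y (b i)| := by
    rcases abs_choice (inner ℝ y (b i)) with h | h
    exacts [⟨-1, by simp [h]⟩, ⟨1, by simp [h]⟩]
  refine ⟨i, σ, fun s hs => ?_⟩
  set w := ∑ j, s j • axisFrame b i σ j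
  set S := ∑ j, s j
  have hs0 (j : Fin n) : 0 ≤ s j := (hs j).1.le
  have hw : ‖w‖ ≤ 3 * S := norm_sum_smul_axisFrame_le b hs0
  have hn : (1 : ℝ) ≤ n := by exact_mod_cast NeZero.one_le
  have hr : 0 < r := (norm_nonneg y).trans_lt hy
  have hS0 : 0 ≤ S := Finset.sum_nonneg fun j _ => hs0 j
  have hS : 9 * (n * S) ≤ r := by
    calc 9 * (n * S) ≤ 9 * (n * (n * (r / (9 * n ^ 2)))) := by
          gcongr
          simpa using Finset.sum_le_card_nsmul Finset.univ s _ fun j _ => (hs j).2.trans hρ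
      _ = r := by field_simp
  rcases lt_or_ge ‖y‖ (r / 2) with hlt | hge
  · nlinarith [norm_add_le y w]
  · have hsmall : 9 * S ≤ 2 * |inner ℝ y (b i)| := by
      have hyn := norm_le_mul_abs_inner b hi
      exact le_of_mul_le_mul_left (by linarith) (zero_lt_one.trans_le hn)
    have hsq : ‖y + w‖ ^ 2 ≤ ‖y‖ ^ 2 := by
      have hinner := inner_sum_smul_axisFrame_le b hs0 hi hσ
      have hw2 : ‖w‖ ^ 2 ≤ (3 * S) ^ 2 := pow_le_pow_left₀ (norm_nonneg _) hw 2
      rw [norm_add_sq_real]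
      nlinarith
    exact (pow_le_pow_iff_left₀ (norm_nonneg _) (norm_nonneg _) two_ne_zero).1 hsq |>.trans_lt hy

end AxisFrames

theorem exists_dyadic_mem_Icc {c : ℝ} (hc : 0 < c) :
    ∃ m k : ℕ, (k : ℝ) / 2 ^ m ∈ Icc c (2 * c) := by
  obtain ⟨m, hm⟩ := exists_pow_lt_of_lt_one hc (show (1 / 2 : ℝ) < 1 by norm_num)
  have hp : (0 : ℝ) < 2 ^ m := by positivity
  rw [one_div_pow, div_lt_iff₀ hp] at hm
  refine ⟨m, ⌈c * 2 ^ m⌉₊, ?_, ?_⟩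
  · rw [le_div_iff₀ hp]
    exact Nat.le_ceil _
  · rw [div_le_iff₀ hp]
    linarith [Nat.ceil_lt_add_one (show 0 ≤ c * 2 ^ m by positivity)]

section Enlargement

/-- `E'` contains every ball in which `E` misses less than the proportion `s`. -/
def AbsorbsBalls {V : Type*} [PseudoMetricSpace V] [MeasurableSpace V] (μ : Measure V) (s : ℝ≥0)
    (E E' : Set V) : Prop :=
  ∀ x r, μ (Metric.ball x r \ E) < s * μ (Metric.ball x r) → Metric.ball x r ⊆ E'

variable {V : Type*} [NormedAddCommGroup V] [InnerProductSpace ℝ V] [MeasurableSpace V]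
  [BorelSpace V] {n : ℕ} (b : OrthonormalBasis (Fin n) ℝ V) (μ : Measure V)
  [μ.IsAddHaarMeasure]

theorem exists_mul_volume_axisFrame_coord_le [NeZero n] :
    ∃ κ : ℝ≥0, 0 < κ ∧ ∀ i σ (x : V) (S : Set V),
      κ * volume {s : Fin n → ℝ | x + ∑ j, s j • axisFrame b i σ j ∈ S} ≤ μ S := by
  have : FiniteDimensional ℝ V := b.toBasis.finiteDimensional_of_finite
  have hscale (p : Fin n × ℤˣ) : ∃ κ : ℝ≥0, 0 < κ ∧ ∀ (x : V) (S : Set V),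
      κ * volume {s : Fin n → ℝ | x + ∑ j, s j • axisFrame b p.1 p.2 j ∈ S} = μ S := by
    have hli := linearIndependent_axisFrame b.orthonormal.linearIndependent p.1 p.2
    have hcard : Fintype.card (Fin n) = Module.finrank ℝ V :=
      (Module.finrank_eq_card_basis b.toBasis).symm
    simpa only [coe_basisOfLinearIndependentOfCardEqFinrank'] using
      exists_mul_volume_coord_eq_measure
        (basisOfLinearIndependentOfCardEqFinrank' _ hli hcard) μ
  choose κ hκ hvol using hscale
  obtain ⟨p₀, hmin⟩ := Finite.exists_min κ
  refine ⟨κ p₀, hκ p₀, fun i σ x S => ?_⟩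
  rw [← hvol (i, σ) x S]
  gcongr
  exact hmin (i, σ)

theorem exists_mul_pow_le_measure_ball_diff [NeZero n] :
    ∃ κ : ℝ≥0, 0 < κ ∧ ∀ (lam : ℝ≥0∞) (E : Set V), MeasurableSet E → ∀ (x y : V) (r : ℝ),
      y ∈ Metric.ball x r → y ∉ iterHalo lam (axisDirections b) E →
      κ * ((1 - lam) * ENNReal.ofReal r) ^ n ≤ μ (Metric.ball x r \ E) := by
  have : FiniteDimensional ℝ V := b.toBasis.finiteDimensional_of_finite
  obtain ⟨κ, hκ, hvol⟩ := exists_mul_volume_axisFrame_coord_le b μ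
  set a : ℝ≥0 := 1 / (18 * n ^ 2)
  have ha : 0 < a := by
    have : (n : ℝ≥0) ≠ 0 := NeZero.ne _
    positivity
  refine ⟨κ * a ^ n, by positivity, fun lam E hE x y r hy hyE => ?_⟩
  have hr : 0 < r := Metric.pos_of_mem_ball hy
  obtain ⟨m, k, hρ⟩ := exists_dyadic_mem_Icc (c := a * r) (by positivity)
  have hyx : ‖y - x‖ < r := by rwa [← dist_eq_norm]
  obtain ⟨i, σ, hbox⟩ := exists_axisFrame_box_subset_ball b hyx (hρ.2.trans_eq (by
    simp only [a]; push_cast; field_simp; norm_num))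
  have hframe : y ∉ iterHalo lam (List.ofFn (axisFrame b i σ)) E := fun h => hyE <|
    iterHalo_subset_of_sublist (List.sublist_flatten_of_mem
      (List.mem_map.2 ⟨(i, σ), by simp, rfl⟩)) h
  calc ((κ * a ^ n : ℝ≥0) : ℝ≥0∞) * ((1 - lam) * ENNReal.ofReal r) ^ n
      = κ * ((1 - lam) * ENNReal.ofReal (a * r)) ^ n := by
        rw [ENNReal.ofReal_mul a.coe_nonneg, ENNReal.ofReal_coe_nnreal]
        push_cast
        ring
    _ ≤ κ * ((1 - lam) * ENNReal.ofReal (k / 2 ^ m)) ^ n := by gcongr; exact hρ.1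
    _ ≤ κ * volume {s : Fin n → ℝ | y + ∑ j, s j • axisFrame b i σ j ∈ Metric.ball x r \ E} := by
        gcongr
        refine (le_volume_box_of_notMem_iterHalo _ hE hframe).trans (measure_mono fun s hs => ?_)
        refine ⟨?_, hs.2⟩
        rw [mem_ball_iff_norm, add_sub_right_comm]
        exact hbox s hs.1
    _ ≤ μ (Metric.ball x r \ E) := hvol i σ y _

open Module in
theorem exists_enlargement_absorbsBalls [FiniteDimensional ℝ V] [Nontrivial V] :
    ∃ c : ℝ≥0, 0 < c ∧ ∃ N : ℕ, ∀ δ : ℝ≥0, 0 < δ → δ ≤ 1 → ∀ E : Set V, MeasurableSet E →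
      ∃ E', E ⊆ E' ∧ MeasurableSet E' ∧ (1 - δ : ℝ≥0∞) ^ N * μ E' ≤ μ E ∧
        AbsorbsBalls μ (c * δ ^ finrank ℝ V) E E' := by
  have : NeZero (finrank ℝ V) := ⟨finrank_pos.ne'⟩
  set b := stdOrthonormalBasis ℝ V
  obtain ⟨κ, hκ, hmiss⟩ := exists_mul_pow_le_measure_ball_diff b μ
  set ω : ℝ≥0 := (μ (Metric.ball (0 : V) 1)).toNNReal
  have hω : (ω : ℝ≥0∞) = μ (Metric.ball (0 : V) 1) := ENNReal.coe_toNNReal measure_ball_lt_top.ne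
  have hω0 : 0 < ω := by
    rw [← ENNReal.coe_pos, hω]
    exact Metric.measure_ball_pos μ 0 one_pos
  refine ⟨κ / ω, by positivity, (axisDirections b).length, fun δ hδ hδ1 E hE => ?_⟩
  have hlam : (1 - δ : ℝ≥0∞) < 1 := ENNReal.sub_lt_self (by simp) (by simp) (by simpa using hδ.ne')
  refine ⟨iterHalo (1 - δ) (axisDirections b) E, subset_iterHalo _, measurableSet_iterHalo hE _,
    pow_mul_measure_iterHalo_le hlam hE _, fun x r hlt y hy => ?_⟩
  by_contra hyE
  refine hlt.not_ge (le_trans (le_of_eq ?_) (hmiss _ E hE x y r hy hyE))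
  have hr : 0 < r := Metric.pos_of_mem_ball hy
  rw [Measure.addHaar_ball_of_pos μ x hr, ← hω, ENNReal.ofReal_pow hr.le,
    ENNReal.sub_sub_cancel (by simp) (by exact_mod_cast hδ1)]
  have hκω : κ = κ / ω * ω := (div_mul_cancel₀ κ hω0.ne').symm
  conv_rhs => rw [hκω]
  push_cast
  ring

end Enlargement

theorem continuousOn_of_monotoneOn_of_continuousOn_add {f g : ℝ → ℝ} {s : Set ℝ}
    (hf : MonotoneOn f s) (hg : MonotoneOn g s) (hfg : ContinuousOn (f + g) s) :
    ContinuousOn f s := by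
  have hle : ∀ a ∈ s, ∀ b ∈ s, a ≤ b → dist (f a) (f b) ≤ dist ((f + g) a) ((f + g) b) := by
    intro a ha b hb hab
    have hf' := hf ha hb hab
    have hg' := hg ha hb hab
    rw [dist_comm, dist_comm ((f + g) a), Real.dist_eq, Real.dist_eq, Pi.add_apply, Pi.add_apply,
      abs_of_nonneg (by linarith), abs_of_nonneg (by linarith)]
    linarith
  intro b hb
  refine tendsto_iff_dist_tendsto_zero.2 <| squeeze_zero' (.of_forall fun _ => dist_nonneg) ?_
    (tendsto_iff_dist_tendsto_zero.1 (hfg b hb))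
  filter_upwards [self_mem_nhdsWithin] with a ha
  rcases le_total a b with hab | hba
  · exact hle a ha b hb hab
  · simpa only [dist_comm] using hle b hb a ha hba

theorem continuousOn_measureReal_sdiff {α : Type*} [MeasurableSpace α] {μ : Measure α}
    {B : ℝ → Set α} {s : Set ℝ} {E : Set α} (hE : MeasurableSet E) (hB : Monotone B)
    (hfin : ∀ τ, μ (B τ) ≠ ∞) (hc : ContinuousOn (fun τ => μ.real (B τ)) s) :
    ContinuousOn (fun τ => μ.real (B τ \ E)) s := by
  refine continuousOn_of_monotoneOn_of_continuousOn_add (g := fun τ => μ.real (B τ ∩ E))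
    (fun a _ b _ hab => ?_) (fun a _ b _ hab => ?_) (hc.congr fun τ _ => ?_)
  · exact measureReal_mono (sdiff_subset_sdiff_left (hB hab)) (measure_ne_top_of_subset
      sdiff_subset (hfin b))
  · exact measureReal_mono (inter_subset_inter_left _ (hB hab)) (measure_ne_top_of_subset
      inter_subset_left (hfin b))
  · rw [Pi.add_apply, add_comm]
    exact measureReal_inter_add_sdiff hE (h := hfin τ)

section Gain

variable {V : Type*} [NormedAddCommGroup V] [NormedSpace ℝ V]

/-- For `0 < τ`, the image of the ball `B(c, r)` under the homothety with centre `x` and ratio `τ`;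
as `τ` decreases from `1` these balls shrink from `B(c, r)` towards `x`. -/
def homotheticBall (x c : V) (r τ : ℝ) : Set V :=
  Metric.ball (AffineMap.lineMap x c τ) (τ * r)

theorem homotheticBall_one (x c : V) (r : ℝ) : homotheticBall x c r 1 = Metric.ball c r := by
  simp [homotheticBall]

theorem monotone_homotheticBall {x c : V} {r : ℝ} (hx : dist x c ≤ r) :
    Monotone (homotheticBall x c r) := by
  intro a b hab
  refine Metric.ball_subset_ball' ?_
  rw [dist_lineMap_lineMap, dist_comm, Real.dist_eq, abs_of_nonneg (sub_nonneg.2 hab)]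
  linarith [mul_le_mul_of_nonneg_left hx (sub_nonneg.2 hab)]

theorem mem_closedBall_lineMap {x c : V} {r τ : ℝ} (hx : dist x c ≤ r) (hτ : 0 ≤ τ) :
    x ∈ Metric.closedBall (AffineMap.lineMap x c τ : V) (τ * r) := by
  rw [Metric.mem_closedBall, dist_left_lineMap, Real.norm_of_nonneg hτ]
  gcongr

variable [FiniteDimensional ℝ V] [MeasurableSpace V] [BorelSpace V] (μ : Measure V)
  [μ.IsAddHaarMeasure] {E E' : Set V}

theorem mul_measure_le_of_forall_mem_closedBall {A F : Set V} {t : ℝ≥0∞} {R : ℝ}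
    (h : ∀ x ∈ A, ∃ w ρ, 0 < ρ ∧ ρ ≤ R ∧ x ∈ Metric.closedBall w ρ ∧
      t * μ (Metric.ball w ρ) ≤ μ (Metric.ball w ρ ∩ F)) :
    t * μ A ≤ 5 ^ Module.finrank ℝ V * μ F := by
  choose! w ρ hρ0 hρR hxw ht using h
  obtain ⟨u, huA, hdisj, hcov⟩ := Vitali.exists_disjoint_subfamily_covering_enlargement_closedBall
    A w ρ R hρR 5 (by norm_num)
  replace hdisj : u.PairwiseDisjoint fun x => Metric.ball (w x) (ρ x) :=
    hdisj.mono_on fun _ _ => Metric.ball_subset_closedBall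
  have hu : u.Countable := hdisj.countable_of_isOpen (fun _ _ => Metric.isOpen_ball)
    fun x hx => Metric.nonempty_ball.2 (hρ0 x (huA hx))
  have hcover : A ⊆ ⋃ x ∈ u, Metric.closedBall (w x) (5 * ρ x) := fun x hx =>
    let ⟨y, hy, hsub⟩ := hcov x hx
    mem_iUnion₂.2 ⟨y, hy, hsub (hxw x hx)⟩
  have henlarge (x : u) : μ (Metric.closedBall (w x) (5 * ρ x)) =
      5 ^ Module.finrank ℝ V * μ (Metric.ball (w x) (ρ x)) := by
    have hρ := hρ0 x (huA x.2)
    rw [Measure.addHaar_closedBall_mul μ _ (by norm_num) hρ.le, Measure.addHaar_ball_of_pos μ _ hρ,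
      Measure.addHaar_closedBall μ _ hρ.le, ENNReal.ofReal_pow (by norm_num), ENNReal.ofReal_ofNat]
  calc t * μ A ≤ t * ∑' x : u, μ (Metric.closedBall (w x) (5 * ρ x)) := by
        gcongr
        exact (measure_mono hcover).trans (measure_biUnion_le _ hu _)
    _ = 5 ^ Module.finrank ℝ V * ∑' x : u, t * μ (Metric.ball (w x) (ρ x)) := by
        simp_rw [henlarge, ENNReal.tsum_mul_left]
        ring
    _ ≤ 5 ^ Module.finrank ℝ V * ∑' x : u, μ.restrict F (Metric.ball (w x) (ρ x)) := by
        gcongr with x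
        rw [Measure.restrict_apply measurableSet_ball]
        exact ht x (huA x.2)
    _ ≤ 5 ^ Module.finrank ℝ V * μ F := by
        gcongr
        rw [← measure_biUnion hu hdisj fun _ _ => measurableSet_ball,
          ← Measure.restrict_apply_univ F]
        exact measure_mono (subset_univ _)

variable [Nontrivial V]

theorem continuousOn_measureReal_homotheticBall (x c : V) {r : ℝ} (hr : 0 ≤ r) :
    ContinuousOn (fun τ => μ.real (homotheticBall x c r τ)) (Ici 0) := by
  have heq : EqOn (fun τ => μ.real (homotheticBall x c r τ))
      (fun τ => (τ * r) ^ Module.finrank ℝ V * μ.real (Metric.ball (0 : V) 1)) (Ici 0) := by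
    intro τ hτ
    simp only [homotheticBall]
    rw [← Measure.addHaar_real_closedBall_eq_addHaar_real_ball,
      Measure.addHaar_real_closedBall μ _ (mul_nonneg hτ hr)]
  exact ContinuousOn.congr (by fun_prop) heq

open Filter Topology in
theorem ae_eventually_measure_homotheticBall_sdiff_lt (hE : MeasurableSet E) :
    ∀ᵐ x ∂μ, x ∈ E → ∀ (c : V) (r : ℝ) (σ : ℝ≥0∞), 0 < r → dist x c ≤ r → 0 < σ →
      ∀ᶠ τ in 𝓝[>] (0 : ℝ),
        μ (homotheticBall x c r τ \ E) < σ * μ (homotheticBall x c r τ) := by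
  have hdens := (IsUnifLocDoublingMeasure.vitaliFamily μ 1
    ).ae_tendsto_measure_inter_div_of_measurableSet hE.compl
  filter_upwards [hdens] with x hx hxE c r σ hr hxc hσ
  rw [indicator_of_notMem (notMem_compl_iff.2 hxE)] at hx
  have hball : ∀ᶠ τ in 𝓝[>] (0 : ℝ),
      x ∈ Metric.closedBall (AffineMap.lineMap x c τ) (1 * (τ * r)) := by
    filter_upwards [self_mem_nhdsWithin] with τ hτ
    rw [one_mul]
    exact mem_closedBall_lineMap hxc (le_of_lt hτ)
  have hradius : Tendsto (fun τ : ℝ => τ * r) (𝓝[>] 0) (𝓝[>] 0) := by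
    refine tendsto_nhdsWithin_iff.2 ⟨?_, ?_⟩
    · simpa using ((continuous_mul_const r).tendsto 0).mono_left nhdsWithin_le_nhds
    · filter_upwards [self_mem_nhdsWithin] with τ hτ using mul_pos hτ hr
  have hlim := hx.comp
    (IsUnifLocDoublingMeasure.tendsto_closedBall_filterAt μ _ _ hradius hball)
  filter_upwards [hlim.eventually_lt_const hσ, self_mem_nhdsWithin] with τ hlt hτ
  have hpos : 0 < τ * r := mul_pos hτ hr
  rw [Function.comp_apply, Measure.addHaar_closedBall_eq_addHaar_ball,
    ENNReal.div_lt_iff (.inl (Metric.measure_ball_pos μ _ hpos).ne')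
      (.inl measure_ball_lt_top.ne)] at hlt
  refine lt_of_le_of_lt (measure_mono ?_) hlt
  rw [homotheticBall, sdiff_eq, inter_comm]
  exact inter_subset_inter_right _ Metric.ball_subset_closedBall

open Filter Topology in
theorem exists_measure_homotheticBall_sdiff_eq (hE : MeasurableSet E) {x c : V} {r : ℝ} {σ : ℝ≥0}
    (hr : 0 < r) (hxc : dist x c ≤ r) (hlarge : σ * μ (Metric.ball c r) ≤ μ (Metric.ball c r \ E))
    (hsmall : ∀ᶠ τ in 𝓝[>] (0 : ℝ),
      μ (homotheticBall x c r τ \ E) < σ * μ (homotheticBall x c r τ)) :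
    ∃ τ ∈ Ioc (0 : ℝ) 1, μ (homotheticBall x c r τ \ E) = σ * μ (homotheticBall x c r τ) := by
  set H := homotheticBall x c r
  have hfin (τ : ℝ) : μ (H τ) ≠ ∞ := measure_ball_lt_top.ne
  have hfin' (τ : ℝ) : μ (H τ \ E) ≠ ∞ := measure_ne_top_of_subset sdiff_subset (hfin τ)
  have hfinσ (τ : ℝ) : σ * μ (H τ) ≠ ∞ := ENNReal.mul_ne_top ENNReal.coe_ne_top (hfin τ)
  obtain ⟨τ₀, hτ₀, hlt, hpos⟩ := (hsmall.and (Ioc_mem_nhdsGT (zero_lt_one (α := ℝ)))).exists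
  have hc : ContinuousOn (fun τ => μ.real (H τ)) (Icc τ₀ 1) :=
    (continuousOn_measureReal_homotheticBall μ x c hr.le).mono fun τ hτ => hlt.le.trans hτ.1
  have hcσ : ContinuousOn (fun τ => (σ * μ (H τ)).toReal) (Icc τ₀ 1) := by
    simp_rw [ENNReal.toReal_mul]
    exact continuousOn_const.mul hc
  have hlarge' : σ * μ (H 1) ≤ μ (H 1 \ E) := by
    rwa [show H 1 = Metric.ball c r from homotheticBall_one x c r]
  obtain ⟨τ, hτ, heq⟩ := isPreconnected_Icc.intermediate_value₂ (left_mem_Icc.2 hpos)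
    (right_mem_Icc.2 hpos) (continuousOn_measureReal_sdiff hE (monotone_homotheticBall hxc) hfin hc)
    hcσ (ENNReal.toReal_mono (hfinσ τ₀) hτ₀.le) (ENNReal.toReal_mono (hfin' 1) hlarge')
  exact ⟨τ, ⟨hlt.trans_le hτ.1, hτ.2⟩,
    (ENNReal.toReal_eq_toReal_iff' (hfin' τ) (hfinσ τ)).1 heq⟩

theorem AbsorbsBalls.mul_measure_inter_ball_le_measure_sdiff {s : ℝ≥0}
    (habs : AbsorbsBalls μ s E E') (hE : MeasurableSet E) (hs : 0 < s) {c : V} {r : ℝ}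
    (hcr : ¬ Metric.ball c r ⊆ E') :
    ((s / 2 : ℝ≥0) : ℝ≥0∞) * μ (E ∩ Metric.ball c r) ≤
      5 ^ Module.finrank ℝ V * μ ((E' ∩ Metric.ball c r) \ E) := by
  have hr : 0 < r := Metric.nonempty_ball.1 (nonempty_of_not_subset hcr |>.mono sdiff_subset)
  have hlarge : ((s / 2 : ℝ≥0) : ℝ≥0∞) * μ (Metric.ball c r) ≤ μ (Metric.ball c r \ E) := by
    refine le_trans ?_ (not_lt.1 (mt (habs c r) hcr))
    gcongr
    exact half_le_self zero_le
  -- Almost every `x` in `E ∩ B(c, r)` is in the closure of a smaller ball that `E'` absorbs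
  -- although `E` misses the proportion `s / 2` of it.
  set A := {x | x ∈ E ∩ Metric.ball c r ∧ ∃ τ ∈ Ioc (0 : ℝ) 1,
    μ (homotheticBall x c r τ \ E) = (s / 2 : ℝ≥0) * μ (homotheticBall x c r τ)}
  have hA : μ (E ∩ Metric.ball c r) ≤ μ A := by
    refine measure_mono_ae ?_
    filter_upwards [ae_eventually_measure_homotheticBall_sdiff_lt μ hE] with x hx hxE
    have hxc : dist x c ≤ r := (Metric.mem_ball.1 hxE.2).le
    exact ⟨hxE, exists_measure_homotheticBall_sdiff_eq μ hE hr hxc hlarge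
      (hx hxE.1 c r _ hr hxc (by simpa using hs.ne'))⟩
  refine le_trans (by gcongr) (mul_measure_le_of_forall_mem_closedBall μ (A := A) (R := r) ?_)
  rintro x ⟨⟨-, hxc⟩, τ, ⟨hτ0, hτ1⟩, hτ⟩
  have hxc' : dist x c ≤ r := (Metric.mem_ball.1 hxc).le
  have hin : homotheticBall x c r τ ⊆ Metric.ball c r :=
    (monotone_homotheticBall hxc' hτ1).trans_eq (homotheticBall_one x c r)
  have habsorbed : homotheticBall x c r τ ⊆ E' := by
    refine habs _ _ (hτ.trans_lt ?_)
    exact ENNReal.mul_lt_mul_left (Metric.measure_ball_pos μ _ (mul_pos hτ0 hr)).ne'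
      measure_ball_lt_top.ne (by exact_mod_cast half_lt_self hs)
  refine ⟨_, _, mul_pos hτ0 hr, mul_le_of_le_one_left hr.le hτ1,
    mem_closedBall_lineMap hxc' hτ0.le, hτ.symm.trans_le (measure_mono fun y hy => ?_)⟩
  exact ⟨hy.1, ⟨habsorbed hy.1, hin hy.1⟩, hy.2⟩

theorem AbsorbsBalls.mul_measure_inter_ball_le {s : ℝ≥0} (habs : AbsorbsBalls μ s E E')
    (hE : MeasurableSet E) (hsub : E ⊆ E') (hs : 0 < s) {c : V} {r : ℝ}
    (hcr : ¬ Metric.ball c r ⊆ E') :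
    ((1 + s / (2 * 5 ^ Module.finrank ℝ V) : ℝ≥0) : ℝ≥0∞) * μ (E ∩ Metric.ball c r) ≤
      μ (E' ∩ Metric.ball c r) := by
  have hcoef : ((1 + s / (2 * 5 ^ Module.finrank ℝ V) : ℝ≥0) : ℝ≥0∞) =
      1 + (5 ^ Module.finrank ℝ V)⁻¹ * (s / 2 : ℝ≥0) := by
    rw [mul_comm 2, mul_comm _ ((s / 2 : ℝ≥0) : ℝ≥0∞), ← div_div, div_right_comm, div_eq_mul_inv,
      ENNReal.coe_add, ENNReal.coe_mul, ENNReal.coe_inv (by positivity)]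
    simp
  rw [hcoef, add_mul, one_mul, mul_assoc, ← measure_inter_add_sdiff (E' ∩ Metric.ball c r) hE]
  refine add_le_add (measure_mono fun x hx => ⟨⟨hsub hx.1, hx.2⟩, hx.1⟩) ?_
  rw [← ENNReal.div_eq_inv_mul]
  exact ENNReal.div_le_of_le_mul' (habs.mul_measure_inter_ball_le_measure_sdiff μ hE hs hcr)

end Gain

section Tauberian

variable {n : ℕ} {B : Set (Set (EuclideanSpace ℝ (Fin n)))} {α : ℝ}
  {E E' : Set (EuclideanSpace ℝ (Fin n))}

theorem maximalOp_indicator_one_le_one (x : EuclideanSpace ℝ (Fin n)) :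
    maximalOp B (E.indicator fun _ => (1 : ℝ)) x ≤ 1 := by
  refine iSup₂_le fun R _ => ?_
  calc (∫⁻ y in R, ‖E.indicator (fun _ => (1 : ℝ)) y‖ₑ) / volume R
      ≤ (∫⁻ _ in R, 1) / volume R := by
        gcongr with y
        by_cases hy : y ∈ E <;> simp [hy]
    _ = volume R / volume R := by rw [setLIntegral_one]
    _ ≤ 1 := ENNReal.div_self_le_one

theorem haloSet_eq_empty_of_one_le (hα : 1 ≤ α) : haloSet B α E = ∅ :=
  eq_empty_of_forall_notMem fun x hx => lt_irrefl (1 : ℝ≥0∞) <|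
    (ENNReal.one_le_ofReal.2 hα).trans_lt (lt_of_lt_of_le hx (maximalOp_indicator_one_le_one x))

theorem tauberianConst_antitone : Antitone (tauberianConst B) := fun _ _ h =>
  iSup₂_mono fun _ _ => ENNReal.div_le_div_right (measure_mono fun _ hx =>
    (ENNReal.ofReal_le_ofReal h).trans_lt hx) _

theorem volume_haloSet_le_tauberianConst_mul (hE : MeasurableSet E) (h0 : volume E ≠ 0)
    (hfin : volume E ≠ ∞) :
    volume (haloSet B α E) ≤ tauberianConst B α * volume E := by
  rw [← ENNReal.div_le_iff h0 hfin]
  exact le_iSup₂_of_le E ⟨hE, pos_iff_ne_zero.2 h0, hfin.lt_top⟩ le_rfl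

theorem mul_tauberianConst_le {t K : ℝ≥0∞}
    (h : ∀ E, MeasurableSet E → volume E ≠ 0 → volume E ≠ ∞ →
      t * volume (haloSet B α E) ≤ K * volume E) :
    t * tauberianConst B α ≤ K := by
  simp_rw [tauberianConst, ENNReal.mul_iSup]
  refine iSup₂_le fun E hE => ?_
  rw [← mul_div_assoc, ENNReal.div_le_iff hE.2.1.ne' hE.2.2.ne]
  exact h E hE.1 hE.2.1.ne' hE.2.2.ne

theorem tauberianConst_eq_zero_of_one_le (hα : 1 ≤ α) : tauberianConst B α = 0 := by
  simp [tauberianConst, haloSet_eq_empty_of_one_le hα]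

/-- The Tauberian constant, replaced by `1` for `1 ≤ α`, where the supremum defining it is `0`. For
balls this is the continuous extension of `C(α)` from `(0, 1)` to `(0, ∞)`. -/
noncomputable def extTauberianConst (B : Set (Set (EuclideanSpace ℝ (Fin n)))) (α : ℝ) : ℝ≥0∞ :=
  max 1 (tauberianConst B α)

theorem extTauberianConst_antitone : Antitone (extTauberianConst B) := fun _ _ h =>
  max_le_max_left 1 (tauberianConst_antitone h)

theorem extTauberianConst_of_one_le (hα : 1 ≤ α) : extTauberianConst B α = 1 := by
  rw [extTauberianConst, tauberianConst_eq_zero_of_one_le hα, max_eq_left zero_le_one]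

theorem mem_haloSet_ballBasis_iff (hE : MeasurableSet E) {x : EuclideanSpace ℝ (Fin n)} :
    x ∈ haloSet (ballBasis n) α E ↔ ∃ c r, x ∈ Metric.ball c r ∧
      ENNReal.ofReal α * volume (Metric.ball c r) < volume (E ∩ Metric.ball c r) := by
  have hint (R : Set (EuclideanSpace ℝ (Fin n))) :
      ∫⁻ y in R, ‖E.indicator (fun _ => (1 : ℝ)) y‖ₑ = volume (E ∩ R) := by
    simp_rw [enorm_indicator_eq_indicator_enorm, enorm_one]
    rw [lintegral_indicator_const hE, one_mul, Measure.restrict_apply hE]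
  have hdiv (c : EuclideanSpace ℝ (Fin n)) {r : ℝ} (hr : 0 < r) :
      ENNReal.ofReal α < volume (E ∩ Metric.ball c r) / volume (Metric.ball c r) ↔
        ENNReal.ofReal α * volume (Metric.ball c r) < volume (E ∩ Metric.ball c r) :=
    ENNReal.lt_div_iff_mul_lt (.inl (Metric.measure_ball_pos volume c hr).ne')
      (.inl measure_ball_lt_top.ne)
  simp only [haloSet, maximalOp, mem_ofPred_eq, lt_iSup_iff, hint, ballBasis]
  constructor
  · rintro ⟨R, ⟨⟨c, r, hr, rfl⟩, hx⟩, h⟩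
    exact ⟨c, r, hx, (hdiv c hr).1 h⟩
  · rintro ⟨c, r, hx, h⟩
    have hr := Metric.pos_of_mem_ball hx
    exact ⟨_, ⟨⟨c, r, hr, rfl⟩, hx⟩, (hdiv c hr).2 h⟩

theorem mem_haloSet_ballBasis_of_ball_subset (hE : MeasurableSet E) (hα : α < 1)
    {x c : EuclideanSpace ℝ (Fin n)} {r : ℝ} (hx : x ∈ Metric.ball c r)
    (hsub : Metric.ball c r ⊆ E) : x ∈ haloSet (ballBasis n) α E := by
  refine (mem_haloSet_ballBasis_iff hE).2 ⟨c, r, hx, ?_⟩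
  rw [inter_eq_self_of_subset_right hsub]
  refine (ENNReal.mul_lt_mul_left (Metric.measure_ball_pos volume c
    (Metric.pos_of_mem_ball hx)).ne' measure_ball_lt_top.ne ?_).trans_eq (one_mul _)
  exact ENNReal.ofReal_lt_one.2 hα

theorem one_le_tauberianConst_ballBasis (hα : α < 1) : 1 ≤ tauberianConst (ballBasis n) α := by
  set U : Set (EuclideanSpace ℝ (Fin n)) := Metric.ball 0 1
  have hU0 : volume U ≠ 0 := (Metric.measure_ball_pos volume _ one_pos).ne'
  have hU : volume U ≠ ∞ := measure_ball_lt_top.ne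
  have hsub : U ⊆ haloSet (ballBasis n) α U := fun x hx =>
    mem_haloSet_ballBasis_of_ball_subset measurableSet_ball hα hx Subset.rfl
  simpa [ENNReal.div_self hU0 hU] using ENNReal.div_le_of_le_mul <|
    (measure_mono hsub).trans (volume_haloSet_le_tauberianConst_mul measurableSet_ball hU0 hU)

theorem extTauberianConst_ballBasis_of_lt_one (hα : α < 1) :
    extTauberianConst (ballBasis n) α = tauberianConst (ballBasis n) α :=
  max_eq_right (one_le_tauberianConst_ballBasis hα)

variable [NeZero n]

theorem AbsorbsBalls.volume_haloSet_le {s : ℝ≥0} (habs : AbsorbsBalls volume s E E')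
    (hE : MeasurableSet E) (hE' : MeasurableSet E') (hsub : E ⊆ E') (hs : 0 < s)
    (h0 : volume E ≠ 0) (hfin : volume E' ≠ ∞) :
    volume (haloSet (ballBasis n) α E) ≤
      extTauberianConst (ballBasis n) (α * (1 + s / (2 * 5 ^ n))) * volume E' := by
  set q : ℝ≥0 := 1 + s / (2 * 5 ^ n)
  have hgrow : ∀ x ∈ haloSet (ballBasis n) α E,
      (∃ c r, x ∈ Metric.ball c r ∧ Metric.ball c r ⊆ E') ∨
        x ∈ haloSet (ballBasis n) (α * q) E' := by
    intro x hx
    obtain ⟨c, r, hxB, hlt⟩ := (mem_haloSet_ballBasis_iff hE).1 hx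
    refine or_iff_not_imp_left.2 fun hcr => (mem_haloSet_ballBasis_iff hE').2 ⟨c, r, hxB, ?_⟩
    have hgain := habs.mul_measure_inter_ball_le volume hE hsub hs (fun h => hcr ⟨c, r, hxB, h⟩)
    rw [finrank_euclideanSpace_fin] at hgain
    refine lt_of_lt_of_le ?_ hgain
    rw [mul_comm α, ENNReal.ofReal_mul q.coe_nonneg, ENNReal.ofReal_coe_nnreal, mul_assoc]
    exact ENNReal.mul_lt_mul_right (by simp [q]) ENNReal.coe_ne_top hlt
  have h0' : volume E' ≠ 0 := fun h => h0 (measure_mono_null hsub h)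
  have hq : α * (1 + s / (2 * 5 ^ n)) = α * q := by simp [q]
  rw [hq]
  rcases lt_or_ge (α * q) 1 with h1 | h1
  · rw [extTauberianConst_ballBasis_of_lt_one h1]
    refine (measure_mono fun x hx => ?_).trans (volume_haloSet_le_tauberianConst_mul hE' h0' hfin)
    rcases hgrow x hx with ⟨c, r, hxB, hB⟩ | h
    · exact mem_haloSet_ballBasis_of_ball_subset hE' h1 hxB hB
    · exact h
  · rw [extTauberianConst_of_one_le h1, one_mul]
    refine measure_mono fun x hx => ?_
    rcases hgrow x hx with ⟨c, r, hxB, hB⟩ | h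
    · exact hB hxB
    · simp [haloSet_eq_empty_of_one_le h1] at h

variable (n) in
theorem exists_pow_mul_extTauberianConst_le :
    ∃ c : ℝ≥0, 0 < c ∧ ∃ N : ℕ, ∀ δ : ℝ≥0, 0 < δ → δ < 1 → ∀ α : ℝ,
      (1 - δ : ℝ≥0∞) ^ N * extTauberianConst (ballBasis n) α ≤
        extTauberianConst (ballBasis n) (α * (1 + c * δ ^ n)) := by
  obtain ⟨c, hc, N, hN⟩ :=
    exists_enlargement_absorbsBalls (volume : Measure (EuclideanSpace ℝ (Fin n)))
  rw [finrank_euclideanSpace_fin] at hN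
  refine ⟨c / (2 * 5 ^ n), by positivity, N, fun δ hδ hδ1 α => ?_⟩
  have hpow : (1 - δ : ℝ≥0∞) ^ N ≤ 1 := pow_le_one₀ zero_le tsub_le_self
  have hpow0 : (1 - δ : ℝ≥0∞) ^ N ≠ 0 := pow_ne_zero _ (by simpa [tsub_eq_zero_iff_le] using hδ1)
  rw [extTauberianConst, mul_max, mul_one]
  refine max_le (hpow.trans (le_max_left _ _)) (mul_tauberianConst_le fun E hE h0 hfin => ?_)
  obtain ⟨E', hsub, hE', hvol, habs⟩ := hN δ hδ hδ1.le E hE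
  have hfin' : volume E' ≠ ∞ :=
    (ENNReal.lt_top_of_mul_ne_top_right (ne_top_of_le_ne_top hfin hvol) hpow0).ne
  have hhalo := habs.volume_haloSet_le (α := α) hE hE' hsub (by positivity) h0 hfin'
  have hcoef : (c * δ ^ n : ℝ≥0) / (2 * 5 ^ n) = (c / (2 * 5 ^ n) : ℝ≥0) * (δ : ℝ) ^ n := by
    push_cast
    ring
  rw [hcoef] at hhalo
  calc (1 - δ : ℝ≥0∞) ^ N * volume (haloSet (ballBasis n) α E)
      ≤ (1 - δ : ℝ≥0∞) ^ N * (extTauberianConst (ballBasis n) _ * volume E') := by gcongr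
    _ = extTauberianConst (ballBasis n) _ * ((1 - δ : ℝ≥0∞) ^ N * volume E') := by ring
    _ ≤ _ := by gcongr

theorem extTauberianConst_ballBasis_lt_top (hα : 0 < α) :
    extTauberianConst (ballBasis n) α < ∞ := by
  obtain ⟨c, hc, N, hN⟩ := exists_pow_mul_extTauberianConst_le n
  set q : ℝ := 1 + c * ((1 / 2 : ℝ≥0) : ℝ) ^ n
  have hq : 1 < q := lt_add_of_pos_right 1 (by positivity)
  obtain ⟨k, hk⟩ := pow_unbounded_of_one_lt (1 / α) hq
  replace hk : 1 ≤ α * q ^ k := by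
    rw [div_lt_iff₀' hα] at hk
    exact hk.le
  induction k generalizing α with
  | zero =>
    rw [extTauberianConst_of_one_le (by simpa using hk)]
    exact ENNReal.one_lt_top
  | succ k ih =>
    have hnext : extTauberianConst (ballBasis n) (α * q) < ∞ :=
      ih (by positivity) (by rwa [mul_assoc, ← pow_succ'])
    refine ENNReal.lt_top_of_mul_ne_top_right
      ((hN (1 / 2) (by positivity) (by norm_num) α).trans_lt hnext).ne (pow_ne_zero _ ?_)
    simp

end Tauberian

section Holder

theorem holderOnWith_of_forall_le_abs_sub_le {f : ℝ → ℝ} {K : Set ℝ} {A p : ℝ≥0}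
    (h : ∀ x ∈ K, ∀ y ∈ K, x ≤ y → |f x - f y| ≤ A * (y - x) ^ (p : ℝ)) :
    HolderOnWith A p f K := by
  have key : ∀ x ∈ K, ∀ y ∈ K, dist (f x) (f y) ≤ A * dist x y ^ (p : ℝ) := by
    intro x hx y hy
    rcases le_total x y with hxy | hyx
    · rw [dist_comm x, Real.dist_eq, Real.dist_eq, abs_of_nonneg (sub_nonneg.2 hxy)]
      exact h x hx y hy hxy
    · rw [dist_comm, Real.dist_eq, Real.dist_eq, abs_of_nonneg (sub_nonneg.2 hyx)]
      exact h y hy x hx hyx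
  intro x hx y hy
  rw [edist_nndist, edist_nndist, ← ENNReal.coe_rpow_of_nonneg _ p.coe_nonneg]
  exact_mod_cast key x hx y hy

variable {p q : ℝ≥0} {I J : Set ℝ} {f g : ℝ → ℝ}

theorem LocHolderClass.mono (hf : LocHolderClass p I f) (hJ : J ⊆ I) : LocHolderClass p J f :=
  fun K hK hc => hf K (hK.trans hJ) hc

theorem LocHolderClass.of_le (hf : LocHolderClass p I f) (hq : q ≤ p) : LocHolderClass q I f := by
  intro K hK hc
  obtain ⟨A, hA⟩ := hf K hK hc
  obtain ⟨D, hD⟩ := Metric.isBounded_iff_nndist.1 hc.isBounded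
  exact ⟨_, hA.of_le (D := D) (fun x hx y hy => by
    rw [edist_nndist]
    exact_mod_cast hD hx hy) hq⟩

theorem LocHolderClass.congr (hf : LocHolderClass p I f) (hfg : EqOn f g I) :
    LocHolderClass p I g := by
  intro K hK hc
  obtain ⟨A, hA⟩ := hf K hK hc
  refine ⟨A, fun x hx y hy => ?_⟩
  rw [← hfg (hK hx), ← hfg (hK hy)]
  exact hA x hx y hy

theorem LocHolderClass.add (hf : LocHolderClass p I f) (hg : LocHolderClass p I g) :
    LocHolderClass p I (f + g) := by
  intro K hK hc
  obtain ⟨A, hA⟩ := hf K hK hc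
  obtain ⟨A', hA'⟩ := hg K hK hc
  refine ⟨A + A', holderOnWith_of_forall_le_abs_sub_le fun x hx y hy hxy => ?_⟩
  have hA := hA.dist_le hx hy
  have hA' := hA'.dist_le hx hy
  rw [dist_comm x, Real.dist_eq, Real.dist_eq, abs_of_nonneg (sub_nonneg.2 hxy)] at hA hA'
  calc |(f + g) x - (f + g) y| ≤ |f x - f y| + |g x - g y| := by
        rw [Pi.add_apply, Pi.add_apply, add_sub_add_comm]
        exact abs_add_le _ _
    _ ≤ A * (y - x) ^ (p : ℝ) + A' * (y - x) ^ (p : ℝ) := add_le_add hA hA'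
    _ = (A + A' : ℝ≥0) * (y - x) ^ (p : ℝ) := by push_cast; ring

theorem LocHolderClass.comp_lipschitzWith (hf : LocHolderClass p J f) {C : ℝ≥0}
    (hg : LipschitzWith C g) (hmaps : MapsTo g I J) : LocHolderClass p I (f ∘ g) := by
  intro K hK hc
  obtain ⟨A, hA⟩ := hf (g '' K) (hmaps.mono_left hK).image_subset (hc.image hg.continuous)
  have hcomp := hA.comp (holderOnWith_one.2 (hg.lipschitzOnWith (s := K))) (mapsTo_image g K)
  rw [mul_one] at hcomp
  exact ⟨_, hcomp⟩

theorem locHolderClass_one_of_lipschitzWith {C : ℝ≥0} (hf : LipschitzWith C f) :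
    LocHolderClass 1 I f :=
  fun _ _ _ => ⟨C, holderOnWith_one.2 hf.lipschitzOnWith⟩

theorem sub_le_of_pow_mul_le {u v δ : ℝ} {N : ℕ} (hδ : 0 ≤ δ) (hu : 0 ≤ u) (hv : 0 ≤ v)
    (h : δ < 1 → (1 - δ) ^ N * u ≤ v) : u - v ≤ (N + 1) * δ * u := by
  rcases lt_or_ge δ 1 with hδ1 | hδ1
  · have hbernoulli : 1 - N * δ ≤ (1 - δ) ^ N := by
      simpa [sub_eq_add_neg] using one_add_mul_le_pow (show -2 ≤ -δ by linarith) N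
    nlinarith [h hδ1, mul_le_mul_of_nonneg_right hbernoulli hu, mul_nonneg hδ hu]
  · nlinarith [mul_le_mul_of_nonneg_right hδ1 hu, mul_nonneg N.cast_nonneg (mul_nonneg hδ hu)]

theorem locHolderClass_of_pow_mul_le {n N : ℕ} (hn : n ≠ 0) {c : ℝ} (hc : 0 < c)
    (hf : AntitoneOn f (Ioi 0)) (hf0 : ∀ α, 0 < α → 0 ≤ f α)
    (h : ∀ α, 0 < α → ∀ δ, 0 < δ → δ < 1 → (1 - δ) ^ N * f α ≤ f (α * (1 + c * δ ^ n))) :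
    LocHolderClass (1 / n) (Ioi 0) f := by
  intro K hK hKc
  rcases K.eq_empty_or_nonempty with rfl | hne
  · exact ⟨0, holderOnWith_empty _ _ _⟩
  obtain ⟨a, haK, ha⟩ := hKc.exists_isLeast hne
  have ha0 : 0 < a := hK haK
  have hfa : 0 ≤ f a := hf0 a ha0
  set p : ℝ := 1 / n with hp
  refine ⟨((N + 1) * f a / (c * a) ^ p).toNNReal,
    holderOnWith_of_forall_le_abs_sub_le fun x hx y hy hxy => ?_⟩
  have hx0 : 0 < x := hK hx
  have hyx : 0 ≤ y - x := sub_nonneg.2 hxy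
  set δ : ℝ := ((y - x) / (c * x)) ^ p
  have hδ : 0 ≤ δ := by positivity
  have hδy : x * (1 + c * δ ^ n) = y := by
    rw [← Real.rpow_natCast δ, ← Real.rpow_mul (by positivity), hp,
      one_div_mul_cancel (by exact_mod_cast hn), Real.rpow_one]
    field_simp
    ring
  have hstep : δ < 1 → (1 - δ) ^ N * f x ≤ f y := by
    intro hδ1
    rcases hδ.eq_or_lt with hδ0 | hδ0
    · rw [← hδ0, zero_pow hn] at hδy
      simp [← hδ0, ← hδy]
    · simpa only [hδy] using h x hx0 δ hδ0 hδ1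
  rw [abs_of_nonneg (sub_nonneg.2 (hf hx0 (hK hy) hxy)), Real.coe_toNNReal _ (by positivity)]
  calc f x - f y ≤ (N + 1) * δ * f x := sub_le_of_pow_mul_le hδ (hf0 x hx0) (hf0 y (hK hy)) hstep
    _ ≤ (N + 1) * ((y - x) / (c * a)) ^ p * f a := by
        have hax : a ≤ x := ha hx
        have hfx : f x ≤ f a := hf ha0 hx0 hax
        have hfx0 : 0 ≤ f x := hf0 x hx0
        simp only [δ]
        gcongr
    _ = (N + 1) * f a / (c * a) ^ p * (y - x) ^ p := by
        rw [Real.div_rpow hyx (by positivity)]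
        ring
    _ = _ := by simp [hp]

end Holder

section HaloFunction

theorem toReal_haloFun_ballBasis (n : ℕ) {x : ℝ} (hx : 0 ≤ x) :
    (haloFun (ballBasis n) x).toReal =
      (extTauberianConst (ballBasis n) (max x 1)⁻¹).toReal + (min x 1 - 1) := by
  rcases le_or_gt x 1 with hx1 | hx1
  · rw [haloFun, if_pos hx1, ENNReal.toReal_ofReal hx, max_eq_right hx1, min_eq_left hx1, inv_one,
      extTauberianConst_of_one_le le_rfl, ENNReal.toReal_one, add_sub_cancel]
  · rw [haloFun, if_neg hx1.not_ge, max_eq_left hx1.le, min_eq_right hx1.le, sub_self, add_zero,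
      one_div, extTauberianConst_ballBasis_of_lt_one (inv_lt_one_of_one_lt₀ hx1)]

theorem lipschitzWith_inv_max_one : LipschitzWith 1 fun x : ℝ => (max x 1)⁻¹ := by
  refine .of_dist_le_mul fun x y => ?_
  have hx : 1 ≤ max x 1 := le_max_right _ _
  have hy : 1 ≤ max y 1 := le_max_right _ _
  rw [dist_inv_inv₀ (by positivity) (by positivity), Real.norm_of_nonneg (by positivity),
    Real.norm_of_nonneg (by positivity)]
  exact (div_le_self dist_nonneg (one_le_mul_of_one_le_of_one_le hx hy)).trans
    ((LipschitzWith.id.max_const 1).dist_le_mul x y)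

variable (n : ℕ) [NeZero n]

theorem locHolderClass_extTauberianConst_ballBasis :
    LocHolderClass (1 / n) (Ioi 0) (fun α => (extTauberianConst (ballBasis n) α).toReal) := by
  obtain ⟨c, hc, N, hN⟩ := exists_pow_mul_extTauberianConst_le n
  refine locHolderClass_of_pow_mul_le (N := N) (NeZero.ne n) (NNReal.coe_pos.2 hc)
    (fun α hα β _ hαβ => ?_) (fun _ _ => ENNReal.toReal_nonneg) fun α hα δ hδ hδ1 => ?_
  · exact ENNReal.toReal_mono (extTauberianConst_ballBasis_lt_top hα).ne
      (extTauberianConst_antitone hαβ)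
  · lift δ to ℝ≥0 using hδ.le
    norm_cast at hδ hδ1
    have h := ENNReal.toReal_mono (extTauberianConst_ballBasis_lt_top (by positivity)).ne
      (hN δ hδ hδ1 α)
    rwa [ENNReal.toReal_mul, ENNReal.toReal_pow, ENNReal.toReal_sub_of_le
      (by exact_mod_cast hδ1.le) ENNReal.one_ne_top, ENNReal.toReal_one, ENNReal.coe_toReal] at h

theorem tauberianConst_ballBasis_lt_top {α : ℝ} (hα : 0 < α) :
    tauberianConst (ballBasis n) α < ∞ :=
  (le_max_right _ _).trans_lt (extTauberianConst_ballBasis_lt_top hα)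

theorem locHolderClass_tauberianConst_ballBasis :
    LocHolderClass (1 / n) (Ioo 0 1) (fun α => (tauberianConst (ballBasis n) α).toReal) :=
  ((locHolderClass_extTauberianConst_ballBasis n).mono fun _ hα => hα.1).congr fun α hα => by
    simp only [extTauberianConst_ballBasis_of_lt_one hα.2]

theorem haloFun_ballBasis_lt_top (x : ℝ) : haloFun (ballBasis n) x < ∞ := by
  unfold haloFun
  split_ifs with hx
  · exact ENNReal.ofReal_lt_top
  · have : 0 < x := one_pos.trans (not_le.1 hx)
    exact tauberianConst_ballBasis_lt_top n (by positivity)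

theorem locHolderClass_haloFun_ballBasis :
    LocHolderClass (1 / n) (Ici 0) (fun x => (haloFun (ballBasis n) x).toReal) := by
  have hn : (1 / n : ℝ≥0) ≤ 1 := by simpa using Nat.cast_inv_le_one n
  have hlow : LipschitzWith 1 fun x : ℝ => min x 1 - 1 := by
    simpa using (LipschitzWith.id.min_const (1 : ℝ)).sub (LipschitzWith.const 1)
  have hhigh := (locHolderClass_extTauberianConst_ballBasis n).comp_lipschitzWith
    lipschitzWith_inv_max_one (I := Ici 0)
    fun x _ => mem_Ioi.2 (inv_pos.2 (lt_max_of_lt_right one_pos))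
  exact (hhigh.add ((locHolderClass_one_of_lipschitzWith hlow).of_le hn)).congr
    fun x hx => (toReal_haloFun_ballBasis n hx).symm

end HaloFunction

theorem theoremt_general (n : ℕ) (hn : 1 ≤ n) :
    ((∀ x ∈ Ici (0 : ℝ), haloFun (ballBasis n) x < ∞) ∧
      LocHolderClass (1 / (n : ℝ≥0)) (Ici (0 : ℝ))
        (fun x => (haloFun (ballBasis n) x).toReal)) ∧
    ((∀ α ∈ Ioo (0 : ℝ) 1, tauberianConst (ballBasis n) α < ∞) ∧
      LocHolderClass (1 / (n : ℝ≥0)) (Ioo (0 : ℝ) 1)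
        (fun α => (tauberianConst (ballBasis n) α).toReal)) := by
  have : NeZero n := ⟨by lia⟩
  exact ⟨⟨fun x _ => haloFun_ballBasis_lt_top n x, locHolderClass_haloFun_ballBasis n⟩,
    fun _ hα => tauberianConst_ballBasis_lt_top n hα.1, locHolderClass_tauberianConst_ballBasis n⟩

theorem theoremt (n : ℕ) (hn : 1 ≤ n) :
    ((∀ x ∈ Ici (0 : ℝ), haloFun (ballBasis n) x < ∞) ∧
      LocHolderClass (1 / ((n : ℝ≥0) + 1)) (Ici (0 : ℝ))
        (fun x => (haloFun (ballBasis n) x).toReal)) ∧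
    ((∀ α ∈ Ioo (0 : ℝ) 1, tauberianConst (ballBasis n) α < ∞) ∧
      LocHolderClass (1 / (n : ℝ≥0)) (Ioo (0 : ℝ) 1)
        (fun α => (tauberianConst (ballBasis n) α).toReal)) ∧
    LocHolderClass (1 / (n : ℝ≥0)) (Ioi (1 : ℝ))
      (fun x => (haloFun (ballBasis n) x).toReal) := by
  obtain ⟨⟨hφ, hφHolder⟩, hC⟩ := theoremt_general n hn
  have hexp : 1 / ((n : ℝ≥0) + 1) ≤ 1 / n :=
    one_div_le_one_div_of_le (Nat.cast_pos.2 hn) le_self_add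
  exact ⟨⟨hφ, hφHolder.of_le hexp⟩, hC, hφHolder.mono (Ioi_subset_Ici zero_le_one)⟩
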